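/- Let $b$ be an analytic function on the open unit disc $\mathbb D$ with values in the complex $n\times n$ matrices such that $\|b(z)\|<1$ (operator norm) for all $z\in\mathbb D$, and let $\alpha$ be a unitary $n\times n$ matrix. Let $\boldsymbol\mu^\alpha$ be the Aleksandrov--Clark measure of $b$, that is, the unique finite non-negative $\mathbb C^{n\times n}$-valued Borel measure on the unit circle $\mathbb T$ such that, with $H_\alpha(z)=(I+b(z)\alpha^*)(I-b(z)\alpha^*)^{-1}$ and $\operatorname{Im}A=(A-A^*)/(2i)$, $$H_\alpha(z)=i\operatorname{Im}H_\alpha(0)+\int_{\mathbb T}\frac{\zeta+z}{\zeta-z}\,\boldsymbol\mu^\alpha(d\zeta),\qquad z\in\mathbb D .$$ Let $\lambda\in\mathbb T$, suppose $\boldsymbol\mu^\alpha\{\lambda\}\neq0$, and let $E=\operatorname{Ran}\boldsymbol\mu^\alpha\{\lambda\}$, with orthogonal projection $P_E$. Then $b\alpha^*$ has a Carathéodory angular derivative at $\lambda$ on the subspace $E$, meaning that $b(z)\alpha^*\mathbf e\to\mathbf e$ for every $\mathbf e\in E$ and that the limit $$\operatorname{CAD}_E(b\alpha^*)(\lambda)=\lim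 P_E\,(b\alpha^*)'(z)\,P_E$$ exists, where both limits are taken as $z\to\lambda$ non-tangentially, i.e. within each Stolz region $\{z\in\mathbb D:|z-\lambda|<t(1-|z|)\}$, $t>1$. Moreover, the Moore--Penrose inverse of the matrix $\operatorname{CAD}_E(b\alpha^*)(\lambda)$ equals $\lambda\,\boldsymbol\mu^\alpha\{\lambda\}$. -/

import Mathlib

open MeasureTheory Filter Topology

/-- The unit circle `𝕋`, with its Borel σ-algebra. -/
abbrev UnitCircle : Type := Metric.sphere (0 : ℂ) 1

/-- The Stolz region `Γ_t(λ)` in the unit disc. -/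
def stolzRegion (t : ℝ) (lam : UnitCircle) : Set ℂ :=
  {z | z ∈ Metric.ball (0 : ℂ) 1 ∧ ‖z - (lam : ℂ)‖ < t * (1 - ‖z‖)}

/-- `f(z) → a` as `z → λ` non-tangentially, i.e. from within each Stolz region at `λ`. -/
def NontangentialTendsto {X : Type*} [TopologicalSpace X] (f : ℂ → X) (lam : UnitCircle) (a : X) :
    Prop :=
  ∀ t : ℝ, 1 < t → Tendsto f (𝓝[stolzRegion t lam] (lam : ℂ)) (𝓝 a)

section Operators

/- `V` is a complex Hilbert space, below `ℂⁿ = EuclideanSpace ℂ (Fin n)`. Complex `n × n` matrices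
with the operator norm are the bounded operators `V →L[ℂ] V`, and `star` is the adjoint. -/
variable {V : Type*} [NormedAddCommGroup V] [InnerProductSpace ℂ V] [CompleteSpace V]

/-- The Schur class: purely contractive analytic matrix functions on the open unit disc. -/
structure IsSchur (b : ℂ → V →L[ℂ] V) : Prop where
  differentiableOn : DifferentiableOn ℂ b (Metric.ball 0 1)
  norm_lt_one : ∀ z ∈ Metric.ball (0 : ℂ) 1, ‖b z‖ < 1

/-- The Herglotz function `H_α(z) = (I + b(z) α*) (I - b(z) α*)⁻¹`. -/
noncomputable def herglotzFun (b : ℂ → V →L[ℂ] V) (α : unitary (V →L[ℂ] V)) (z : ℂ) : V →L[ℂ] V :=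
  (1 + b z * star (α : V →L[ℂ] V)) * Ring.inverse (1 - b z * star (α : V →L[ℂ] V))

/-- `∫ f(ζ) μ(dζ)` for a scalar function `f` and a matrix-valued measure `μ` on the circle. -/
noncomputable def matrixIntegral (μ : VectorMeasure UnitCircle (V →L[ℂ] V))
    (f : UnitCircle → ℂ) : V →L[ℂ] V :=
  μ.integral f (ContinuousLinearMap.lsmul ℝ ℂ)

/-- `μ` is the Aleksandrov–Clark measure `μ^α` of `b`: the non-negative matrix-valued (countably
additive, hence finite) Borel measure on the circle representing the Herglotz function `H_α`. Here
`imaginaryPart A = (A - A*) / (2i)`. -/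
structure IsClarkMeasure (b : ℂ → V →L[ℂ] V) (α : unitary (V →L[ℂ] V))
    (μ : VectorMeasure UnitCircle (V →L[ℂ] V)) : Prop where
  nonneg : ∀ s : Set UnitCircle, MeasurableSet s → (μ s).IsPositive
  herglotz : ∀ z ∈ Metric.ball (0 : ℂ) 1,
    herglotzFun b α z = Complex.I • (imaginaryPart (herglotzFun b α 0) : V →L[ℂ] V)
      + matrixIntegral μ (fun ζ => ((ζ : ℂ) + z) / ((ζ : ℂ) - z))

/-- `f` has a Carathéodory angular derivative at `λ` on the subspace `E`, with
`CAD_E f(λ) = A`; the orthogonal projection onto `E` is regarded as an operator on `ℂⁿ`. -/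
structure HasCADOn (f : ℂ → V →L[ℂ] V) (E : Submodule ℂ V) [E.HasOrthogonalProjection]
    (lam : UnitCircle) (A : V →L[ℂ] V) : Prop where
  tendsto_apply : ∀ e ∈ E, NontangentialTendsto (fun z => f z e) lam e
  tendsto_deriv :
    NontangentialTendsto (fun z => E.starProjection * deriv f z * E.starProjection) lam A

/-- `X` is the Moore–Penrose inverse of `A`: the four Penrose equations, which determine `X`. -/
structure IsMoorePenroseInverse (A X : V →L[ℂ] V) : Prop where
  mul_mul_left : A * X * A = A
  mul_mul_right : X * A * X = X
  star_left : star (A * X) = A * X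
  star_right : star (X * A) = X * A

end Operators

/-- Complex `n × n` matrices with the operator norm, as operators on `ℂⁿ`. -/
abbrev Op (n : ℕ) : Type := EuclideanSpace ℂ (Fin n) →L[ℂ] EuclideanSpace ℂ (Fin n)

/-! ### Positive operators: Cauchy–Schwarz and the trace bound. -/

section PositiveOperators

variable {V : Type*} [NormedAddCommGroup V] [InnerProductSpace ℂ V] [CompleteSpace V]

/-! Put `θ = bα*`, `M = μ{λ}`, `e = M v` and `u = (1 - θ(z))* e`. Pairing the Cayley transform of
`θ` with `u` gives `2⟨f, e⟩ = ⟨f, u⟩ + ⟨H(z) f, u⟩`, with no inverse left on the left-hand side;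
everything is read off from this identity and the Herglotz formula for `H`.

Taking `f = u` and real parts produces the Poisson energy of `u`. Cauchy–Schwarz at the atom then
gives Julia's inequality (`IsHerglotzRepr.julia`): in a Stolz region this integral of the squared
Cauchy kernel stays bounded, and `‖u‖² = O(|z - λ|)`.

For general `f`, split the integral at `λ`. The atom contributes the difference quotient of `θ`
tested on `Ran M`; the rest vanishes in the limit (`IsHerglotzRepr.tendsto_inner_compl_singleton`).
Hence `(λ - z)⁻¹⟨(1 - θ(z)) M f, M v⟩ → λ⟨f, M v⟩`. Inverting `M` on its range, the quotients of
`PθP` converge to `conj λ • X`, where `X` is the Moore–Penrose inverse of `M`. Cauchy's estimate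
(`nontangentialTendsto_deriv`) passes from quotients to derivatives. -/

lemma ContinuousLinearMap.IsPositive.exists_inner_eq {T : V →L[ℂ] V} (hT : T.IsPositive) :
    ∃ S : V →L[ℂ] V, ∀ x y, inner ℂ (T x) y = inner ℂ (S x) (S y) := by
  obtain ⟨S, rfl⟩ := CStarAlgebra.nonneg_iff_eq_star_mul_self.mp
    ((ContinuousLinearMap.nonneg_iff_isPositive T).mpr hT)
  refine ⟨S, fun x y => ?_⟩
  rw [ContinuousLinearMap.star_eq_adjoint, mul_apply_eq_comp,
    ContinuousLinearMap.adjoint_inner_left]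

/-- The Cauchy–Schwarz inequality for the form of a positive operator. -/
lemma ContinuousLinearMap.IsPositive.norm_inner_sq_le {T : V →L[ℂ] V} (hT : T.IsPositive)
    (x y : V) :
    ‖inner ℂ (T x) y‖ ^ 2 ≤ (inner ℂ (T x) x).re * (inner ℂ (T y) y).re := by
  obtain ⟨S, hS⟩ := hT.exists_inner_eq
  have h : ∀ v : V, (inner ℂ v v).re = ‖v‖ ^ 2 := fun v => inner_self_eq_norm_sq (𝕜 := ℂ) v
  rw [hS, hS, hS, h, h, ← mul_pow]
  gcongr
  exact norm_inner_le_norm _ _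

lemma ContinuousLinearMap.IsPositive.inner_self_eq_re {T : V →L[ℂ] V} (hT : T.IsPositive)
    (x : V) : inner ℂ (T x) x = ((inner ℂ (T x) x).re : ℂ) := by
  obtain ⟨S, hS⟩ := hT.exists_inner_eq
  rw [hS]
  exact (inner_self_ofReal_re (𝕜 := ℂ) (S x)).symm

/-- The operator norm of a positive operator is at most its trace. -/
lemma ContinuousLinearMap.IsPositive.norm_le_trace {ι : Type*} [Fintype ι]
    (e : OrthonormalBasis ι ℂ V) {T : V →L[ℂ] V} (hT : T.IsPositive) :
    ‖T‖ ≤ ∑ i, (inner ℂ (T (e i)) (e i)).re := by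
  obtain ⟨S, rfl⟩ := CStarAlgebra.nonneg_iff_eq_star_mul_self.mp
    ((ContinuousLinearMap.nonneg_iff_isPositive T).mpr hT)
  have h : ∀ i, (inner ℂ ((star S * S) (e i)) (e i)).re = ‖S (e i)‖ ^ 2 := fun i => by
    rw [ContinuousLinearMap.star_eq_adjoint, mul_apply_eq_comp,
      ContinuousLinearMap.adjoint_inner_left]
    exact inner_self_eq_norm_sq (𝕜 := ℂ) _
  simp_rw [h]
  -- By the C*-identity it suffices to bound `‖S‖` by the Hilbert–Schmidt norm of `S`.
  rw [CStarRing.norm_star_mul_self, ← sq]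
  refine (Real.le_sqrt (norm_nonneg _) (Finset.sum_nonneg fun _ _ => sq_nonneg _)).mp ?_
  refine ContinuousLinearMap.opNorm_le_bound _ (Real.sqrt_nonneg _) fun x => ?_
  refine abs_le_of_sq_le_sq' ?_ (by positivity) |>.2
  rw [mul_pow, Real.sq_sqrt (Finset.sum_nonneg fun _ _ => sq_nonneg _)]
  calc ‖S x‖ ^ 2 = ‖∑ i, inner ℂ (e i) x • S (e i)‖ ^ 2 := by
        conv_lhs => rw [← e.sum_repr' x]
        simp
    _ ≤ (∑ i, ‖S (e i)‖ * ‖inner ℂ (e i) x‖) ^ 2 := by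
        gcongr
        refine (norm_sum_le _ _).trans (Finset.sum_le_sum fun i _ => ?_)
        rw [norm_smul, mul_comm]
    _ ≤ (∑ i, ‖S (e i)‖ ^ 2) * ∑ i, ‖inner ℂ (e i) x‖ ^ 2 :=
        Finset.sum_mul_sq_le_sq_mul_sq _ _ _
    _ = _ := by rw [e.sum_sq_norm_inner_right]

end PositiveOperators

/-! ### Integration of scalar functions against positive operator-valued measures. -/

section OperatorMeasures

variable {V : Type*} [NormedAddCommGroup V] [InnerProductSpace ℂ V] [CompleteSpace V]

lemma matrixIntegral_add {μ : VectorMeasure UnitCircle (V →L[ℂ] V)} {φ ψ : UnitCircle → ℂ}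
    (hφ : μ.Integrable φ) (hψ : μ.Integrable ψ) :
    matrixIntegral μ (fun x => φ x + ψ x) = matrixIntegral μ φ + matrixIntegral μ ψ :=
  VectorMeasure.integral_fun_add hφ hψ

lemma matrixIntegral_const_mul {μ : VectorMeasure UnitCircle (V →L[ℂ] V)} (c : ℂ)
    (φ : UnitCircle → ℂ) :
    matrixIntegral μ (fun x => c * φ x) = c • matrixIntegral μ φ :=
  setToFun_smul _ (fun c s x => by
    simp [transpose_eq_cbmApplyMeasure, mul_smul]) c φ

lemma exists_simpleFunc_tendsto {φ : UnitCircle → ℂ} (hφ : Measurable φ) {C : ℝ}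
    (hC : ∀ x, ‖φ x‖ ≤ C) :
    ∃ σ : ℕ → SimpleFunc UnitCircle ℂ, (∀ n x, ‖σ n x‖ ≤ C + C) ∧
      ∀ x, Tendsto (fun n => σ n x) atTop (𝓝 (φ x)) :=
  ⟨SimpleFunc.approxOn φ hφ Set.univ 0 (Set.mem_univ _),
    fun n x => (SimpleFunc.norm_approxOn_zero_le hφ (Set.mem_univ _) x n).trans
      (add_le_add (hC x) (hC x)),
    fun x => SimpleFunc.tendsto_approxOn hφ (Set.mem_univ _) (by simp)⟩

/-- A positive operator-valued measure on a finite-dimensional space has finite variation. -/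
lemma isFiniteMeasure_variation_of_isPositive [FiniteDimensional ℂ V] {X : Type*}
    [MeasurableSpace X] {μ : VectorMeasure X (V →L[ℂ] V)}
    (hμ : ∀ s, MeasurableSet s → (μ s).IsPositive) : IsFiniteMeasure μ.variation := by
  let e := stdOrthonormalBasis ℂ V
  -- The real part of the trace turns `μ` into a finite scalar measure that dominates `‖μ s‖`, hence
  -- the variation.
  let tr : (V →L[ℂ] V) →L[ℝ] ℝ := ∑ i, Complex.reCLM ∘L
    ((innerSL ℂ (e i)).restrictScalars ℝ ∘L
      (ContinuousLinearMap.apply ℂ V (e i)).restrictScalars ℝ)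
  have htr : ∀ T, tr T = ∑ i, (inner ℂ (T (e i)) (e i)).re := fun T => by
    simp only [tr, _root_.sum_apply]
    exact Finset.sum_congr rfl fun i _ => inner_re_symm (𝕜 := ℂ) _ _
  let τ : SignedMeasure X := μ.mapRange tr.toLinearMap.toAddMonoidHom tr.continuous
  have hτ : ∀ s, τ s = tr (μ s) := fun s => rfl
  have hpos : ∀ s, MeasurableSet s → 0 ≤ τ s := fun s hs => by
    rw [hτ, htr]
    exact Finset.sum_nonneg fun i _ => (hμ s hs).re_inner_nonneg_left (e i)
  have hle : VectorMeasure.restrict 0 Set.univ ≤ VectorMeasure.restrict τ Set.univ := by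
    rw [VectorMeasure.restrict_univ, VectorMeasure.restrict_univ]
    exact fun s hs => by simpa using hpos s hs
  refine isFiniteMeasure_of_le (τ.toMeasureOfZeroLE Set.univ MeasurableSet.univ hle)
    (VectorMeasure.variation_le_of_forall_enorm_le fun s hs => ?_)
  rw [SignedMeasure.toMeasureOfZeroLE_apply _ _ _ hs, ← ofReal_norm,
    ← ENNReal.ofReal_eq_coe_nnreal]
  refine ENNReal.ofReal_le_ofReal ?_
  rw [Set.univ_inter, hτ, htr]
  exact (hμ s hs).norm_le_trace e

variable {μ : VectorMeasure UnitCircle (V →L[ℂ] V)} [IsFiniteMeasure μ.variation]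

lemma integrable_variation_of_bounded {φ : UnitCircle → ℂ} (hφ : Measurable φ) {C : ℝ}
    (hC : ∀ x, ‖φ x‖ ≤ C) : μ.Integrable φ :=
  Integrable.of_bound hφ.aestronglyMeasurable C (Eventually.of_forall hC)

lemma matrixIntegral_indicator_const {s : Set UnitCircle} (hs : MeasurableSet s) (c : ℂ) :
    matrixIntegral μ (s.indicator fun _ => c) = c • μ s :=
  VectorMeasure.integral_indicator_const _ hs

lemma matrixIntegral_const (c : ℂ) : matrixIntegral μ (fun _ => c) = c • μ Set.univ := by
  simpa using matrixIntegral_indicator_const (μ := μ) MeasurableSet.univ c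

/-- Keeping `g` apart from `σ` lets `σ`, its real part, its squared modulus and `1` all be
integrated over the same fibres. -/
lemma matrixIntegral_indicator_simpleFunc {s : Set UnitCircle} (hs : MeasurableSet s)
    (σ : SimpleFunc UnitCircle ℂ) (g : ℂ → ℂ) :
    matrixIntegral μ (s.indicator fun ζ => g (σ ζ)) =
      ∑ x ∈ σ.range, g x • μ (s ∩ σ ⁻¹' {x}) := by
  have h : (s.indicator fun ζ => g (σ ζ)) =
      fun ζ => ∑ x ∈ σ.range, (s ∩ σ ⁻¹' {x}).indicator (fun _ => g x) ζ := by
    ext ζ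
    rw [Finset.sum_eq_single (σ ζ)]
    · by_cases hζ : ζ ∈ s <;> simp [hζ]
    · intro x _ hx
      exact Set.indicator_of_notMem (fun h => hx h.2.symm) _
    · intro h
      exact absurd (σ.mem_range_self ζ) h
  have hm : ∀ x, MeasurableSet (s ∩ σ ⁻¹' {x}) := fun x => hs.inter (σ.measurableSet_fiber x)
  rw [h]
  refine (VectorMeasure.integral_finsetSum _ fun x _ => ?_).trans
    (Finset.sum_congr rfl fun x _ => matrixIntegral_indicator_const (hm x) (g x))
  exact (integrable_const (g x)).indicator (hm x)

lemma matrixIntegral_comp_simpleFunc (σ : SimpleFunc UnitCircle ℂ) (g : ℂ → ℂ) :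
    matrixIntegral μ (fun ζ => g (σ ζ)) = ∑ x ∈ σ.range, g x • μ (σ ⁻¹' {x}) := by
  simpa using matrixIntegral_indicator_simpleFunc (μ := μ) MeasurableSet.univ σ g

lemma tendsto_matrixIntegral {φ : ℕ → UnitCircle → ℂ} {ψ : UnitCircle → ℂ} {C : ℝ}
    (hm : ∀ n, Measurable (φ n)) (hC : ∀ n x, ‖φ n x‖ ≤ C)
    (h : ∀ x, Tendsto (fun n => φ n x) atTop (𝓝 (ψ x))) :
    Tendsto (fun n => matrixIntegral μ (φ n)) atTop (𝓝 (matrixIntegral μ ψ)) :=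
  VectorMeasure.tendsto_integral_filter_of_norm_le_const
    (Eventually.of_forall fun n => (hm n).aestronglyMeasurable)
    ⟨C, Eventually.of_forall fun n => Eventually.of_forall (hC n)⟩ (Eventually.of_forall h)

lemma norm_matrixIntegral_le {φ : UnitCircle → ℂ} {C : ℝ} (hC : ∀ x, ‖φ x‖ ≤ C) :
    ‖matrixIntegral μ φ‖ ≤ C * (‖(ContinuousLinearMap.lsmul ℝ ℂ :
      ℂ →L[ℝ] (V →L[ℂ] V) →L[ℝ] (V →L[ℂ] V))‖ * μ.variation.real Set.univ) := by
  rw [← mul_assoc]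
  exact VectorMeasure.norm_integral_le_of_norm_le_const (Eventually.of_forall hC)

lemma re_inner_matrixIntegral_comp_simpleFunc (hμ : ∀ s, MeasurableSet s → (μ s).IsPositive)
    (σ : SimpleFunc UnitCircle ℂ) (g : ℂ → ℂ) (u : V) :
    (inner ℂ (matrixIntegral μ (fun ζ => g (σ ζ)) u) u).re =
      ∑ x ∈ σ.range, (g x).re * (inner ℂ (μ (σ ⁻¹' {x}) u) u).re := by
  rw [matrixIntegral_comp_simpleFunc, _root_.sum_apply, sum_inner, Complex.re_sum]
  refine Finset.sum_congr rfl fun x _ => ?_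
  rw [_root_.smul_apply, inner_smul_left,
    (hμ _ (σ.measurableSet_fiber x)).inner_self_eq_re, Complex.re_mul_ofReal, Complex.conj_re,
    Complex.ofReal_re]

/-- Each `⟨μ(s) u, u⟩` is real, so only the real part of the integrand survives; simple functions
show this and bounded convergence extends it. -/
lemma re_inner_matrixIntegral (hμ : ∀ s, MeasurableSet s → (μ s).IsPositive) {φ : UnitCircle → ℂ}
    (hφ : Measurable φ) {C : ℝ} (hC : ∀ x, ‖φ x‖ ≤ C) (u : V) :
    (inner ℂ (matrixIntegral μ φ u) u).re =
      (inner ℂ (matrixIntegral μ (fun ζ => ((φ ζ).re : ℂ)) u) u).re := by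
  obtain ⟨σ, hσ, hlim⟩ := exists_simpleFunc_tendsto hφ hC
  have hcont : Continuous fun T : V →L[ℂ] V => (inner ℂ (T u) u).re := by fun_prop
  have h₁ := (hcont.tendsto _).comp
    (tendsto_matrixIntegral (μ := μ) (fun n => (σ n).measurable) hσ hlim)
  have h₂ := (hcont.tendsto _).comp
    (tendsto_matrixIntegral (μ := μ) (φ := fun n ζ => ((σ n ζ).re : ℂ)) (C := C + C)
      (ψ := fun ζ => ((φ ζ).re : ℂ))
      (fun n => by fun_prop) (fun n x => by
        rw [Complex.norm_real]
        exact (Complex.abs_re_le_norm _).trans (hσ n x))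
      (fun x => (Complex.continuous_ofReal.comp Complex.continuous_re).continuousAt.tendsto.comp
        (hlim x)))
  refine tendsto_nhds_unique h₁ (h₂.congr fun n => ?_)
  refine (re_inner_matrixIntegral_comp_simpleFunc hμ (σ n) (fun w => (w.re : ℂ)) u).trans ?_
  simpa using (re_inner_matrixIntegral_comp_simpleFunc hμ (σ n) (fun w => w) u).symm

lemma tendsto_matrixIntegral_norm_sq {φ : UnitCircle → ℂ} {σ : ℕ → SimpleFunc UnitCircle ℂ}
    {C : ℝ} (hσ : ∀ n x, ‖σ n x‖ ≤ C) (hlim : ∀ x, Tendsto (fun n => σ n x) atTop (𝓝 (φ x))) :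
    Tendsto (fun n => matrixIntegral μ fun ζ => ((‖σ n ζ‖ ^ 2 : ℝ) : ℂ)) atTop
      (𝓝 (matrixIntegral μ fun ζ => ((‖φ ζ‖ ^ 2 : ℝ) : ℂ))) := by
  refine tendsto_matrixIntegral (C := C ^ 2) (fun n => by fun_prop) (fun n x => ?_) fun x => ?_
  · rw [Complex.norm_real, Real.norm_of_nonneg (sq_nonneg _)]
    gcongr
    exact hσ n x
  · exact (Complex.continuous_ofReal.tendsto _).comp ((hlim x).norm.pow 2)

lemma re_inner_matrixIntegral_norm_sq_nonneg (hμ : ∀ s, MeasurableSet s → (μ s).IsPositive)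
    {φ : UnitCircle → ℂ} (hφ : Measurable φ) {C : ℝ} (hC : ∀ x, ‖φ x‖ ≤ C) (u : V) :
    0 ≤ (inner ℂ (matrixIntegral μ (fun ζ => ((‖φ ζ‖ ^ 2 : ℝ) : ℂ)) u) u).re := by
  obtain ⟨σ, hσ, hlim⟩ := exists_simpleFunc_tendsto hφ hC
  have hcont : Continuous fun T : V →L[ℂ] V => (inner ℂ (T u) u).re := by fun_prop
  refine ge_of_tendsto' ((hcont.tendsto _).comp
    (tendsto_matrixIntegral_norm_sq (μ := μ) hσ hlim)) fun n => ?_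
  refine le_of_le_of_eq ?_
    (re_inner_matrixIntegral_comp_simpleFunc hμ (σ n) (fun w => ((‖w‖ ^ 2 : ℝ) : ℂ)) u).symm
  refine Finset.sum_nonneg fun x _ => mul_nonneg ?_
    ((hμ _ ((σ n).measurableSet_fiber x)).re_inner_nonneg_left u)
  rw [Complex.ofReal_re]
  positivity

/-- The Cauchy–Schwarz inequality for integrals against a positive operator-valued measure. -/
lemma norm_inner_matrixIntegral_indicator_sq_le (hμ : ∀ s, MeasurableSet s → (μ s).IsPositive)
    {s : Set UnitCircle} (hs : MeasurableSet s) {φ : UnitCircle → ℂ} (hφ : Measurable φ) {C : ℝ}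
    (hC : ∀ x, ‖φ x‖ ≤ C) (f u : V) :
    ‖inner ℂ (matrixIntegral μ (s.indicator φ) f) u‖ ^ 2 ≤
      (inner ℂ (μ s f) f).re *
        (inner ℂ (matrixIntegral μ (fun ζ => ((‖φ ζ‖ ^ 2 : ℝ) : ℂ)) u) u).re := by
  obtain ⟨σ, hσ, hlim⟩ := exists_simpleFunc_tendsto hφ hC
  have hcont : Continuous fun T : V →L[ℂ] V => (inner ℂ (T u) u).re := by fun_prop
  have hcont' : Continuous fun T : V →L[ℂ] V => ‖inner ℂ (T f) u‖ ^ 2 := by fun_prop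
  have h₁ := (hcont'.tendsto _).comp
    (tendsto_matrixIntegral (μ := μ) (φ := fun n => s.indicator (σ n)) (ψ := s.indicator φ)
      (C := C + C) (fun n => (σ n).measurable.indicator hs)
      (fun n x => (norm_indicator_le_norm_self _ _).trans (hσ n x)) (fun x => by
        by_cases hx : x ∈ s
        · simpa [hx] using hlim x
        · simp [hx]))
  have h₂ := ((hcont.tendsto _).comp
    (tendsto_matrixIntegral_norm_sq (μ := μ) hσ hlim)).const_mul (inner ℂ (μ s f) f).re
  refine le_of_tendsto_of_tendsto' h₁ h₂ fun n => ?_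
  have hfib := (σ n).measurableSet_fiber
  have hsum : ∑ x ∈ (σ n).range, μ (s ∩ σ n ⁻¹' {x}) = μ s := by
    simpa [matrixIntegral_indicator_const hs] using
      (matrixIntegral_indicator_simpleFunc (μ := μ) hs (σ n) fun _ => 1).symm
  -- Only the `u` factor is enlarged to the whole fibre; the `f` factor keeps `s`, whose mass has to
  -- be small later.
  have hmono : ∀ x, (inner ℂ (μ (s ∩ σ n ⁻¹' {x}) u) u).re ≤
      (inner ℂ (μ (σ n ⁻¹' {x}) u) u).re := fun x => by
    have h := VectorMeasure.of_add_of_sdiff (v := μ) (hs.inter (hfib x)) (hfib x)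
      Set.inter_subset_right
    rw [← h, _root_.add_apply, inner_add_left, Complex.add_re]
    exact le_add_of_nonneg_right
      ((hμ _ ((hfib x).diff (hs.inter (hfib x)))).re_inner_nonneg_left u)
  simp only [Function.comp_apply]
  rw [re_inner_matrixIntegral_comp_simpleFunc hμ (σ n) (fun w => ((‖w‖ ^ 2 : ℝ) : ℂ)) u,
    matrixIntegral_indicator_simpleFunc hs (σ n) fun w => w, ← hsum,
    _root_.sum_apply, _root_.sum_apply, sum_inner, sum_inner,
    Complex.re_sum]
  have hpos := fun x => hμ _ (hs.inter (hfib x))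
  calc _ ≤ (∑ x ∈ (σ n).range, ‖x‖ * ‖inner ℂ (μ (s ∩ σ n ⁻¹' {x}) f) u‖) ^ 2 := by
        gcongr
        refine (norm_sum_le _ _).trans (Finset.sum_le_sum fun x _ => ?_)
        rw [_root_.smul_apply, inner_smul_left, norm_mul, RCLike.norm_conj]
    _ ≤ _ := by
        -- Discrete Cauchy–Schwarz over the fibres, with the whole weight `‖x‖²` placed on the `u`
        -- factor.
        refine Finset.sum_sq_le_sum_mul_sum_of_sq_le_mul _
          (fun x _ => (hpos x).re_inner_nonneg_left f) (fun x _ => mul_nonneg ?_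
            ((hμ _ (hfib x)).re_inner_nonneg_left u)) fun x _ => ?_
        · rw [Complex.ofReal_re]; positivity
        · rw [Complex.ofReal_re, mul_pow]
          calc _ ≤ ‖x‖ ^ 2 * ((inner ℂ (μ (s ∩ σ n ⁻¹' {x}) f) f).re *
                (inner ℂ (μ (s ∩ σ n ⁻¹' {x}) u) u).re) := by
                gcongr
                exact (hpos x).norm_inner_sq_le f u
            _ ≤ ‖x‖ ^ 2 * ((inner ℂ (μ (s ∩ σ n ⁻¹' {x}) f) f).re *
                (inner ℂ (μ (σ n ⁻¹' {x}) u) u).re) := by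
                exact mul_le_mul_of_nonneg_left (mul_le_mul_of_nonneg_left (hmono x)
                  ((hpos x).re_inner_nonneg_left f)) (sq_nonneg _)
            _ = _ := by ring

end OperatorMeasures

/-! ### The Cauchy, Herglotz and Poisson kernels. -/

section CauchyKernel

/-- The Cauchy kernel `ζ ↦ (ζ - z)⁻¹` on the circle. -/
noncomputable def circleCauchyKernel (z : ℂ) (ζ : UnitCircle) : ℂ := ((ζ : ℂ) - z)⁻¹

lemma UnitCircle.norm_coe (ζ : UnitCircle) : ‖(ζ : ℂ)‖ = 1 := mem_sphere_zero_iff_norm.mp ζ.2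

lemma measurable_circleCauchyKernel (z : ℂ) : Measurable (circleCauchyKernel z) := by
  unfold circleCauchyKernel
  fun_prop

lemma one_sub_norm_le_norm_sub (z : ℂ) (ζ : UnitCircle) : 1 - ‖z‖ ≤ ‖(ζ : ℂ) - z‖ := by
  simpa [UnitCircle.norm_coe] using norm_sub_norm_le (ζ : ℂ) z

lemma norm_circleCauchyKernel_le {z : ℂ} (hz : ‖z‖ < 1) (ζ : UnitCircle) :
    ‖circleCauchyKernel z ζ‖ ≤ (1 - ‖z‖)⁻¹ := by
  rw [circleCauchyKernel, norm_inv]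
  exact inv_anti₀ (sub_pos.mpr hz) (one_sub_norm_le_norm_sub z ζ)

lemma circle_sub_ne_zero {z : ℂ} (hz : ‖z‖ < 1) (ζ : UnitCircle) : (ζ : ℂ) - z ≠ 0 :=
  norm_pos_iff.mp ((sub_pos.mpr hz).trans_le (one_sub_norm_le_norm_sub z ζ))

lemma herglotzKernel_eq {z : ℂ} (hz : ‖z‖ < 1) (ζ : UnitCircle) :
    ((ζ : ℂ) + z) / ((ζ : ℂ) - z) = 1 + 2 * z * circleCauchyKernel z ζ := by
  have := circle_sub_ne_zero hz ζ
  rw [circleCauchyKernel]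
  field_simp
  ring

lemma re_herglotzKernel (z : ℂ) (ζ : UnitCircle) :
    (((ζ : ℂ) + z) / ((ζ : ℂ) - z)).re = (1 - ‖z‖ ^ 2) * ‖circleCauchyKernel z ζ‖ ^ 2 := by
  have h1 : Complex.normSq (ζ : ℂ) = 1 := by
    rw [Complex.normSq_eq_norm_sq, UnitCircle.norm_coe, one_pow]
  rw [circleCauchyKernel, norm_inv, inv_pow, ← Complex.normSq_eq_norm_sq,
    ← Complex.normSq_eq_norm_sq, Complex.div_re, ← add_div, div_eq_mul_inv]
  congr 1
  rw [Complex.normSq_apply] at h1 ⊢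
  simp only [Complex.add_re, Complex.sub_re, Complex.add_im, Complex.sub_im]
  linear_combination h1

end CauchyKernel

/-! ### The Cayley transform and its Herglotz integral. -/

section Herglotz

variable {V : Type*} [NormedAddCommGroup V] [InnerProductSpace ℂ V] [CompleteSpace V]

/-- The Cayley transform of a strict contraction, tested against `u = (1 - T*) e`. -/
lemma two_mul_inner_eq_inner_cayley {T : V →L[ℂ] V} (hT : ‖T‖ < 1) (f e : V) :
    2 * inner ℂ f e = inner ℂ f (star (1 - T) e) +
      inner ℂ (((1 + T) * Ring.inverse (1 - T)) f) (star (1 - T) e) := by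
  have h1 : (1 - T) * Ring.inverse (1 - T) = 1 :=
    Ring.mul_inverse_cancel _ (isUnit_one_sub_of_norm_lt_one hT)
  have h2 : (1 - T) * ((1 + T) * Ring.inverse (1 - T)) = 2 - (1 - T) := by
    have : (1 - T) * (1 + T) = (1 + T) * (1 - T) := by noncomm_ring
    rw [← mul_assoc, this, mul_assoc, h1, mul_one, ← one_add_one_eq_two]
    abel
  rw [ContinuousLinearMap.star_eq_adjoint, ContinuousLinearMap.adjoint_inner_right,
    ContinuousLinearMap.adjoint_inner_right, ← inner_add_left, ← mul_apply_eq_comp (1 - T), h2,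
    ← _root_.add_apply, add_sub_cancel]
  have h3 : (2 : V →L[ℂ] V) f = f + f := by
    rw [← one_add_one_eq_two]
    rfl
  rw [h3, inner_add_left, two_mul]

variable {μ : VectorMeasure UnitCircle (V →L[ℂ] V)} [IsFiniteMeasure μ.variation]

lemma matrixIntegral_herglotzKernel {z : ℂ} (hz : ‖z‖ < 1) :
    matrixIntegral μ (fun ζ => ((ζ : ℂ) + z) / ((ζ : ℂ) - z)) =
      μ Set.univ + (2 * z) • matrixIntegral μ (circleCauchyKernel z) := by
  have hi : μ.Integrable (circleCauchyKernel z) :=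
    integrable_variation_of_bounded (measurable_circleCauchyKernel z)
      (norm_circleCauchyKernel_le hz)
  simp_rw [herglotzKernel_eq hz]
  rw [matrixIntegral_add (integrable_const 1) (hi.const_mul _), matrixIntegral_const,
    matrixIntegral_const_mul, one_smul]

lemma re_inner_matrixIntegral_herglotzKernel (hμ : ∀ s, MeasurableSet s → (μ s).IsPositive)
    {z : ℂ} (hz : ‖z‖ < 1) (u : V) :
    (inner ℂ (matrixIntegral μ (fun ζ => ((ζ : ℂ) + z) / ((ζ : ℂ) - z)) u) u).re =
      (1 - ‖z‖ ^ 2) * (inner ℂ (matrixIntegral μ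
        (fun ζ => ((‖circleCauchyKernel z ζ‖ ^ 2 : ℝ) : ℂ)) u) u).re := by
  have hC : ∀ ζ : UnitCircle, ‖((ζ : ℂ) + z) / ((ζ : ℂ) - z)‖ ≤ 2 * (1 - ‖z‖)⁻¹ := fun ζ => by
    rw [div_eq_mul_inv, norm_mul]
    refine mul_le_mul ?_ (norm_circleCauchyKernel_le hz ζ) (norm_nonneg _) two_pos.le
    refine (norm_add_le _ _).trans ?_
    rw [UnitCircle.norm_coe]
    linarith
  rw [re_inner_matrixIntegral hμ (by fun_prop) hC]
  simp_rw [re_herglotzKernel z, Complex.ofReal_mul]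
  rw [matrixIntegral_const_mul, _root_.smul_apply, inner_smul_left, Complex.conj_ofReal,
    Complex.re_ofReal_mul]

end Herglotz

/-! ### Julia's inequality in a Stolz region. -/

section Julia

/-- A strictly contractive operator function on the disc together with a positive operator-valued measure that
represents its Cayley transform. -/
structure IsHerglotzRepr {V : Type*} [NormedAddCommGroup V] [InnerProductSpace ℂ V]
    [CompleteSpace V] (θ : ℂ → V →L[ℂ] V) (c : V →L[ℂ] V)
    (μ : VectorMeasure UnitCircle (V →L[ℂ] V)) : Prop where
  norm_lt_one : ∀ z : ℂ, ‖z‖ < 1 → ‖θ z‖ < 1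
  isPositive : ∀ s, MeasurableSet s → (μ s).IsPositive
  isSelfAdjoint : IsSelfAdjoint c
  cayley_eq : ∀ z : ℂ, ‖z‖ < 1 → (1 + θ z) * Ring.inverse (1 - θ z) =
    Complex.I • c + matrixIntegral μ (fun ζ => ((ζ : ℂ) + z) / ((ζ : ℂ) - z))

variable {V : Type*} [NormedAddCommGroup V] [InnerProductSpace ℂ V] [CompleteSpace V]
  {μ : VectorMeasure UnitCircle (V →L[ℂ] V)} [IsFiniteMeasure μ.variation]
  {θ : ℂ → V →L[ℂ] V} {c : V →L[ℂ] V}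

lemma re_inner_I_smul_eq_zero (hc : IsSelfAdjoint c) (u : V) :
    (inner ℂ ((Complex.I • c) u) u).re = 0 := by
  have h : (inner ℂ (c u) u).im = 0 := by
    have := (ContinuousLinearMap.isSelfAdjoint_iff_isSymmetric.mp hc).im_inner_apply_self u
    simpa using this
  rw [_root_.smul_apply, inner_smul_left]
  simp [h]

/-- Real part of the Cayley identity at `f = u`: the skew-adjoint constant drops out and the
Herglotz kernel becomes the Poisson kernel. -/
lemma IsHerglotzRepr.energy_eq (h : IsHerglotzRepr θ c μ) {z : ℂ} (hz : ‖z‖ < 1) (e : V) :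
    (1 - ‖z‖ ^ 2) * (inner ℂ (matrixIntegral μ
        (fun ζ => ((‖circleCauchyKernel z ζ‖ ^ 2 : ℝ) : ℂ)) (star (1 - θ z) e))
          (star (1 - θ z) e)).re =
      2 * (inner ℂ (star (1 - θ z) e) e).re - ‖star (1 - θ z) e‖ ^ 2 := by
  set u := star (1 - θ z) e with hu
  have h1 := congrArg Complex.re (two_mul_inner_eq_inner_cayley (h.norm_lt_one z hz) u e)
  rw [← hu, h.cayley_eq z hz, _root_.add_apply, inner_add_left, Complex.add_re, Complex.add_re,
    re_inner_I_smul_eq_zero h.isSelfAdjoint, zero_add,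
    re_inner_matrixIntegral_herglotzKernel h.isPositive hz] at h1
  have h2 : (inner ℂ u u).re = ‖u‖ ^ 2 := inner_self_eq_norm_sq (𝕜 := ℂ) u
  have h3 : ((2 : ℂ) * inner ℂ u e).re = 2 * (inner ℂ u e).re := by simp
  rw [h2, h3] at h1
  linarith

lemma matrixIntegral_indicator_singleton (lam : UnitCircle) (φ : UnitCircle → ℂ) :
    matrixIntegral μ (({lam} : Set UnitCircle).indicator φ) = φ lam • μ {lam} := by
  rw [← matrixIntegral_indicator_const (measurableSet_singleton lam)]
  congr 1
  ext ζ
  by_cases hζ : ζ = lam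
  · simp [hζ]
  · simp [hζ]

/-- Julia's inequality at an atom of the measure. -/
lemma IsHerglotzRepr.julia (h : IsHerglotzRepr θ c μ) {lam : UnitCircle} {t : ℝ} {z : ℂ}
    (hz : z ∈ stolzRegion t lam) (v : V) :
    (inner ℂ (matrixIntegral μ
        (fun ζ => ((‖circleCauchyKernel z ζ‖ ^ 2 : ℝ) : ℂ)) (star (1 - θ z) (μ {lam} v)))
          (star (1 - θ z) (μ {lam} v))).re ≤ 4 * t ^ 2 * (inner ℂ (μ {lam} v) v).re ∧
      ‖star (1 - θ z) (μ {lam} v)‖ ^ 2 ≤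
        4 * t * (inner ℂ (μ {lam} v) v).re * ‖z - (lam : ℂ)‖ := by
  obtain ⟨hz1, hzt⟩ := hz
  rw [mem_ball_zero_iff] at hz1
  have hen := h.energy_eq hz1 (μ {lam} v)
  set e := μ {lam} v with he
  set u := star (1 - θ z) e
  have hN := re_inner_matrixIntegral_norm_sq_nonneg h.isPositive
    (measurable_circleCauchyKernel z) (norm_circleCauchyKernel_le hz1) u
  have hcs := norm_inner_matrixIntegral_indicator_sq_le h.isPositive
    (measurableSet_singleton lam) (measurable_circleCauchyKernel z)
    (norm_circleCauchyKernel_le hz1) v u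
  rw [matrixIntegral_indicator_singleton, _root_.smul_apply, inner_smul_left, norm_mul,
    RCLike.norm_conj, mul_pow, ← he] at hcs
  have hm := (h.isPositive _ (measurableSet_singleton lam)).re_inner_nonneg_left v
  change 0 ≤ (inner ℂ (μ {lam} v) v).re at hm
  rw [← he] at hm
  set N := (inner ℂ (matrixIntegral μ
        (fun ζ => ((‖circleCauchyKernel z ζ‖ ^ 2 : ℝ) : ℂ)) u) u).re
  set m := (inner ℂ e v).re
  have hre : (inner ℂ u e).re ≤ ‖inner ℂ e u‖ := by
    rw [norm_inner_symm]
    exact Complex.re_le_norm _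
  set p := ‖inner ℂ e u‖
  have hp : 0 ≤ p := norm_nonneg _
  have hq : ‖circleCauchyKernel z lam‖ = ‖z - (lam : ℂ)‖⁻¹ := by
    rw [circleCauchyKernel, norm_inv, norm_sub_rev]
  have hε : 0 < ‖z - (lam : ℂ)‖ := by
    rw [norm_sub_rev]; exact norm_pos_iff.mpr (circle_sub_ne_zero hz1 lam)
  rw [hq] at hcs
  set ε := ‖z - (lam : ℂ)‖
  have hcs' : p ^ 2 ≤ ε ^ 2 * (m * N) := by
    rw [inv_pow, inv_mul_le_iff₀ (by positivity)] at hcs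
    exact hcs
  set d := 1 - ‖z‖ ^ 2 with hd
  have hz0 := norm_nonneg z
  have hd1 : 1 - ‖z‖ ≤ d := by rw [hd]; nlinarith
  have hd0 : 0 < d := by linarith
  have ht : 0 < t := by
    by_contra ht
    nlinarith
  have hεd : ε ≤ t * d := hzt.le.trans (by gcongr)
  have hNp : d * N ≤ 2 * p := by nlinarith [sq_nonneg ‖u‖]
  -- Feeding the energy bound `d * N ≤ 2 * p` into Cauchy–Schwarz at the atom gives a self-improving
  -- inequality; one factor `p` cancels.
  have hpd : p * d ≤ 2 * ε ^ 2 * m := by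
    rcases hp.eq_or_lt with h0 | h0
    · rw [← h0, zero_mul]; positivity
    · refine le_of_mul_le_mul_left ?_ h0
      calc p * (p * d) = d * p ^ 2 := by ring
        _ ≤ d * (ε ^ 2 * (m * N)) := by gcongr
        _ = ε ^ 2 * m * (d * N) := by ring
        _ ≤ ε ^ 2 * m * (2 * p) := by gcongr
        _ = _ := by ring
  have hp2 : p ≤ 2 * t * ε * m := by
    refine le_of_mul_le_mul_right ?_ hd0
    calc p * d ≤ 2 * ε * m * ε := by linarith
      _ ≤ 2 * ε * m * (t * d) := by gcongr
      _ = _ := by ring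
  constructor
  · refine le_of_mul_le_mul_left ?_ hd0
    calc d * N ≤ 2 * p := hNp
      _ ≤ 2 * (2 * t * ε * m) := by gcongr
      _ ≤ 2 * (2 * t * (t * d) * m) := by gcongr
      _ = _ := by ring
  -- Now the energy is discarded instead of `‖u‖²`, leaving `‖u‖² ≤ 2 * p`.
  · have : 0 ≤ d * N := by positivity
    nlinarith

end Julia

/-! ### Non-tangential limits at an atom. -/

section BoundaryLimit

variable {V : Type*} [NormedAddCommGroup V] [InnerProductSpace ℂ V] [CompleteSpace V]
  {μ : VectorMeasure UnitCircle (V →L[ℂ] V)} [IsFiniteMeasure μ.variation]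
  {θ : ℂ → V →L[ℂ] V} {c : V →L[ℂ] V}

lemma tendsto_re_inner_punctured_ball (lam : UnitCircle) (f : V) :
    Tendsto (fun k : ℕ => (inner ℂ (μ (Metric.ball lam (1 / ((k : ℝ) + 1)) \ {lam}) f) f).re)
      atTop (𝓝 0) := by
  have hm : ∀ k : ℕ, MeasurableSet (Metric.ball lam (1 / ((k : ℝ) + 1)) \ {lam}) := fun k =>
    Metric.isOpen_ball.measurableSet.diff (measurableSet_singleton lam)
  have hlim : Tendsto (fun k : ℕ => matrixIntegral μ
      ((Metric.ball lam (1 / ((k : ℝ) + 1)) \ {lam}).indicator fun _ => 1)) atTop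
      (𝓝 (matrixIntegral μ fun _ => 0)) := by
    refine tendsto_matrixIntegral (C := 1) (fun k => measurable_const.indicator (hm k))
      (fun k x => (norm_indicator_le_norm_self _ _).trans (by simp)) fun x => ?_
    by_cases hx : x = lam
    · simp [hx]
    · have hev := (tendsto_one_div_add_atTop_nhds_zero_nat (𝕜 := ℝ)).eventually_lt_const
        (dist_pos.mpr hx)
      refine tendsto_const_nhds.congr' (hev.mono fun k hk => ?_)
      refine (Set.indicator_of_notMem ?_ _).symm
      exact fun h => (Metric.mem_ball.mp h.1).not_gt hk
  have hcont : Continuous fun T : V →L[ℂ] V => (inner ℂ (T f) f).re := by fun_prop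
  refine ((hcont.tendsto _).comp hlim).congr' (Eventually.of_forall fun k => ?_) |>.trans ?_
  · simp only [Function.comp_apply]
    rw [matrixIntegral_indicator_const (hm k), one_smul]
  · rw [matrixIntegral_const]
    simp

lemma tendsto_norm_sub_stolzRegion (t : ℝ) (lam : UnitCircle) :
    Tendsto (fun z : ℂ => ‖z - (lam : ℂ)‖) (𝓝[stolzRegion t lam] (lam : ℂ)) (𝓝 0) := by
  have h : Continuous fun z : ℂ => ‖z - (lam : ℂ)‖ := by fun_prop
  simpa using (h.tendsto (lam : ℂ)).mono_left nhdsWithin_le_nhds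

lemma IsHerglotzRepr.tendsto_star_one_sub (h : IsHerglotzRepr θ c μ) (lam : UnitCircle) (t : ℝ)
    (v : V) :
    Tendsto (fun z => star (1 - θ z) (μ {lam} v)) (𝓝[stolzRegion t lam] (lam : ℂ)) (𝓝 0) := by
  rw [tendsto_zero_iff_norm_tendsto_zero]
  have hsq : Tendsto (fun z => ‖star (1 - θ z) (μ {lam} v)‖ ^ 2)
      (𝓝[stolzRegion t lam] (lam : ℂ)) (𝓝 0) := by
    refine squeeze_zero' (Eventually.of_forall fun _ => sq_nonneg _)
      (eventually_nhdsWithin_of_forall fun z hz => (h.julia hz v).2) ?_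
    simpa using (tendsto_norm_sub_stolzRegion t lam).const_mul
      (4 * t * (inner ℂ (μ {lam} v) v).re)
  simpa using hsq.sqrt

/-- Near `λ` the kernel is unbounded, but Cauchy–Schwarz pairs Julia's bounded energy with the small
mass of a punctured ball. Away from `λ` the kernel is bounded and `u → 0`. -/
lemma IsHerglotzRepr.tendsto_inner_compl_singleton (h : IsHerglotzRepr θ c μ) (lam : UnitCircle)
    (t : ℝ) (v f : V) :
    Tendsto (fun z => inner ℂ (matrixIntegral μ
        (({lam}ᶜ : Set UnitCircle).indicator (circleCauchyKernel z)) f)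
          (star (1 - θ z) (μ {lam} v)))
      (𝓝[stolzRegion t lam] (lam : ℂ)) (𝓝 0) := by
  rw [Metric.tendsto_nhds]
  intro η hη
  set m := (inner ℂ (μ {lam} v) v).re
  obtain ⟨k, hk⟩ : ∃ k : ℕ, (inner ℂ (μ (Metric.ball lam (1 / ((k : ℝ) + 1)) \ {lam}) f) f).re *
      (4 * t ^ 2 * m) < (η / 2) ^ 2 := by
    have h1 := (tendsto_re_inner_punctured_ball (μ := μ) lam f).mul_const (4 * t ^ 2 * m)
    rw [zero_mul] at h1
    exact (h1.eventually_lt_const (by positivity)).exists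
  set δ : ℝ := 1 / ((k : ℝ) + 1)
  have hδ : 0 < δ := by positivity
  have hsm : MeasurableSet (Metric.ball lam δ \ {lam}) :=
    Metric.isOpen_ball.measurableSet.diff (measurableSet_singleton lam)
  set K := 2 / δ * (‖(ContinuousLinearMap.lsmul ℝ ℂ :
      ℂ →L[ℝ] (V →L[ℂ] V) →L[ℝ] (V →L[ℂ] V))‖ * μ.variation.real Set.univ)
  have hfar : ∀ᶠ z in 𝓝[stolzRegion t lam] (lam : ℂ),
      K * ‖f‖ * ‖star (1 - θ z) (μ {lam} v)‖ < η / 2 := by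
    have h1 := (h.tendsto_star_one_sub lam t v).norm.const_mul (K * ‖f‖)
    rw [norm_zero, mul_zero] at h1
    exact h1.eventually_lt_const (by positivity)
  filter_upwards [hfar, self_mem_nhdsWithin,
    (tendsto_norm_sub_stolzRegion t lam).eventually_lt_const (half_pos hδ)] with z hz1 hz hz2
  have hzn : ‖z‖ < 1 := mem_ball_zero_iff.mp hz.1
  have hq := measurable_circleCauchyKernel z
  have hqb := norm_circleCauchyKernel_le hzn
  have hqi : μ.Integrable (circleCauchyKernel z) := integrable_variation_of_bounded hq hqb
  have hsplit : ({lam}ᶜ : Set UnitCircle).indicator (circleCauchyKernel z) = fun ζ =>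
      (Metric.ball lam δ \ {lam}).indicator (circleCauchyKernel z) ζ +
      (Metric.ball lam δ ∪ {lam})ᶜ.indicator (circleCauchyKernel z) ζ := by
    ext ζ
    by_cases h1 : ζ = lam <;> by_cases h2 : ζ ∈ Metric.ball lam δ <;>
      simp [Set.indicator, h1, h2]
  have hfm : MeasurableSet (Metric.ball lam δ ∪ {lam})ᶜ :=
    (Metric.isOpen_ball.measurableSet.union (measurableSet_singleton lam)).compl
  rw [dist_zero_right, hsplit, matrixIntegral_add (hqi.indicator hsm) (hqi.indicator hfm),
    _root_.add_apply, inner_add_left]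
  have hnear := norm_inner_matrixIntegral_indicator_sq_le h.isPositive hsm hq hqb f
    (star (1 - θ z) (μ {lam} v))
  have hnear' : ‖inner ℂ (matrixIntegral μ ((Metric.ball lam δ \ {lam}).indicator
      (circleCauchyKernel z)) f) (star (1 - θ z) (μ {lam} v))‖ < η / 2 := by
    refine lt_of_pow_lt_pow_left₀ 2 (by positivity) ((hnear.trans ?_).trans_lt hk)
    exact mul_le_mul_of_nonneg_left (h.julia hz v).1
      ((h.isPositive _ hsm).re_inner_nonneg_left f)
  have hbound : ∀ ζ, ‖(Metric.ball lam δ ∪ {lam})ᶜ.indicator (circleCauchyKernel z) ζ‖ ≤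
      2 / δ := fun ζ => by
    by_cases hζ : ζ ∈ (Metric.ball lam δ ∪ {lam})ᶜ
    · rw [Set.indicator_of_mem hζ, circleCauchyKernel, norm_inv, ← inv_div]
      refine inv_anti₀ (half_pos hδ) ?_
      have h1 : δ ≤ ‖(ζ : ℂ) - lam‖ := by
        have : ¬ dist ζ lam < δ := fun h => hζ (Or.inl h)
        rw [← dist_eq_norm]
        exact not_lt.mp this
      have h2 := norm_sub_le_norm_sub_add_norm_sub (ζ : ℂ) z lam
      linarith
    · rw [Set.indicator_of_notMem hζ, norm_zero]
      positivity
  have hfar' : ‖inner ℂ (matrixIntegral μ ((Metric.ball lam δ ∪ {lam})ᶜ.indicator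
      (circleCauchyKernel z)) f) (star (1 - θ z) (μ {lam} v))‖ < η / 2 := by
    refine ((norm_inner_le_norm _ _).trans ?_).trans_lt hz1
    gcongr
    refine (ContinuousLinearMap.le_opNorm _ _).trans ?_
    gcongr
    exact norm_matrixIntegral_le hbound
  calc _ ≤ _ := norm_add_le _ _
    _ < η := by linarith

/-- The difference quotient of `θ` at an atom of the representing measure, tested on the range of
the atom. -/
lemma IsHerglotzRepr.tendsto_inner_differenceQuotient (h : IsHerglotzRepr θ c μ)
    (lam : UnitCircle) (t : ℝ) (v f : V) :
    Tendsto (fun z => inner ℂ (((lam : ℂ) - z)⁻¹ • (1 - θ z) (μ {lam} f)) (μ {lam} v))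
      (𝓝[stolzRegion t lam] (lam : ℂ)) (𝓝 (lam * inner ℂ f (μ {lam} v))) := by
  have hu := h.tendsto_star_one_sub lam t v
  have hz : Tendsto (fun z : ℂ => z) (𝓝[stolzRegion t lam] (lam : ℂ)) (𝓝 (lam : ℂ)) :=
    tendsto_id.mono_left nhdsWithin_le_nhds
  have hconj : Tendsto (fun z : ℂ => (starRingEnd ℂ z)⁻¹) (𝓝[stolzRegion t lam] (lam : ℂ))
      (𝓝 (lam : ℂ)) := by
    have hne : starRingEnd ℂ (lam : ℂ) ≠ 0 := by
      rw [← norm_ne_zero_iff, RCLike.norm_conj, UnitCircle.norm_coe]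
      exact one_ne_zero
    have h1 : (starRingEnd ℂ (lam : ℂ))⁻¹ = lam := by
      rw [inv_eq_iff_eq_inv, Complex.inv_def, Complex.normSq_eq_norm_sq, UnitCircle.norm_coe]
      simp
    have h2 := ((Complex.continuous_conj.tendsto _).comp hz).inv₀ hne
    rw [h1] at h2
    exact h2
  -- This is the Cayley identity solved for the atom's term. The conjugates, and the limit `(conj
  -- λ)⁻¹ = λ`, come from the inner product being conjugate-linear in its first slot.
  have hmain := hconj.mul ((tendsto_const_nhds (x := inner ℂ f (μ {lam} v))).sub
    ((((tendsto_const_nhds (x := f + (Complex.I • c) f + μ Set.univ f)).inner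
      (𝕜 := ℂ) hu).div_const 2).add
    (((Complex.continuous_conj.tendsto _).comp hz).mul
      (h.tendsto_inner_compl_singleton lam t v f))))
  simp only [inner_zero_right, zero_div, mul_zero, add_zero, sub_zero] at hmain
  refine hmain.congr' ?_
  have hne0 : ∀ᶠ z in 𝓝[stolzRegion t lam] (lam : ℂ), z ≠ 0 :=
    hz.eventually_ne (by rw [← norm_ne_zero_iff, UnitCircle.norm_coe]; exact one_ne_zero)
  filter_upwards [self_mem_nhdsWithin, hne0] with z hzs hz0
  have hzn : ‖z‖ < 1 := mem_ball_zero_iff.mp hzs.1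
  have hqi : μ.Integrable (circleCauchyKernel z) :=
    integrable_variation_of_bounded (measurable_circleCauchyKernel z)
      (norm_circleCauchyKernel_le hzn)
  have hsplit : circleCauchyKernel z = fun ζ =>
      ({lam} : Set UnitCircle).indicator (circleCauchyKernel z) ζ +
      ({lam}ᶜ : Set UnitCircle).indicator (circleCauchyKernel z) ζ := by
    ext ζ
    exact (Set.indicator_self_add_compl_apply _ _ _).symm
  have hcay := two_mul_inner_eq_inner_cayley (h.norm_lt_one z hzn) f (μ {lam} v)
  have hint : matrixIntegral μ (circleCauchyKernel z) = ((lam : ℂ) - z)⁻¹ • μ {lam} +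
      matrixIntegral μ (({lam}ᶜ : Set UnitCircle).indicator (circleCauchyKernel z)) := by
    conv_lhs => rw [hsplit]
    rw [matrixIntegral_add (hqi.indicator (measurableSet_singleton lam))
      (hqi.indicator (measurableSet_singleton lam).compl), matrixIntegral_indicator_singleton]
    rfl
  rw [h.cayley_eq z hzn, matrixIntegral_herglotzKernel hzn, hint] at hcay
  simp only [_root_.add_apply, _root_.smul_apply, inner_add_left, inner_smul_left, map_mul,
    smul_add] at hcay ⊢
  have hadj : inner ℂ ((1 - θ z) (μ {lam} f)) (μ {lam} v) =
      inner ℂ (μ {lam} f) (star (1 - θ z) (μ {lam} v)) := by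
    rw [ContinuousLinearMap.star_eq_adjoint, ContinuousLinearMap.adjoint_inner_right]
  rw [hadj, inv_mul_eq_iff_eq_mul₀ (by simpa using hz0)]
  simp only [Function.comp_apply, map_ofNat] at hcay ⊢
  linear_combination hcay / 2

/-- Convergence for the adjoint transfers to `θ` by contractivity: `‖θe - e‖² ≤ 2 Re⟨e, (1 - θ)*
e⟩`. -/
lemma IsHerglotzRepr.tendsto_apply (h : IsHerglotzRepr θ c μ) (lam : UnitCircle) (t : ℝ)
    (v : V) :
    Tendsto (fun z => θ z (μ {lam} v)) (𝓝[stolzRegion t lam] (lam : ℂ)) (𝓝 (μ {lam} v)) := by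
  set e := μ {lam} v
  have hu := h.tendsto_star_one_sub lam t v
  rw [tendsto_iff_norm_sub_tendsto_zero]
  have hbound : ∀ z ∈ stolzRegion t lam,
      ‖θ z e - e‖ ^ 2 ≤ 2 * (‖e‖ * ‖star (1 - θ z) e‖) := fun z hz => by
    have hθ : ‖θ z e‖ ≤ ‖e‖ := by
      simpa using (θ z).le_of_opNorm_le (h.norm_lt_one z (mem_ball_zero_iff.mp hz.1)).le e
    have h1 : ‖θ z e - e‖ ^ 2 = ‖θ z e‖ ^ 2 - 2 * (inner ℂ (θ z e) e).re + ‖e‖ ^ 2 :=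
      norm_sub_sq (𝕜 := ℂ) _ _
    have h2 : (inner ℂ (θ z e) e).re = ‖e‖ ^ 2 - (inner ℂ e (star (1 - θ z) e)).re := by
      have h3 : (inner ℂ e e).re = ‖e‖ ^ 2 := inner_self_eq_norm_sq (𝕜 := ℂ) e
      rw [ContinuousLinearMap.star_eq_adjoint, ContinuousLinearMap.adjoint_inner_right, ← h3,
        ← Complex.sub_re, ← inner_sub_left]
      simp
    have h4 : (inner ℂ e (star (1 - θ z) e)).re ≤ ‖e‖ * ‖star (1 - θ z) e‖ :=
      re_inner_le_norm (𝕜 := ℂ) _ _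
    have h5 : ‖θ z e‖ ^ 2 ≤ ‖e‖ ^ 2 := by gcongr
    rw [h1, h2]
    linarith
  have hsq : Tendsto (fun z => ‖θ z e - e‖ ^ 2) (𝓝[stolzRegion t lam] (lam : ℂ)) (𝓝 0) := by
    refine squeeze_zero' (Eventually.of_forall fun _ => sq_nonneg _)
      (eventually_nhdsWithin_of_forall hbound) ?_
    simpa using (hu.norm.const_mul ‖e‖).const_mul 2
  simpa using hsq.sqrt

end BoundaryLimit

/-! ### From difference quotients to derivatives. -/

section AngularDerivative

/-- If the difference quotients of an analytic function at a boundary point converge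
non-tangentially, then so do its derivatives. -/
lemma nontangentialTendsto_deriv {F : Type*} [NormedAddCommGroup F] [NormedSpace ℂ F]
    {g : ℂ → F} (hg : DifferentiableOn ℂ g (Metric.ball 0 1)) {lam : UnitCircle} {a A : F}
    (h : NontangentialTendsto (fun z => ((lam : ℂ) - z)⁻¹ • (a - g z)) lam A) :
    NontangentialTendsto (deriv g) lam A := by
  intro t ht
  -- A disc of radius `(1 - ‖z‖) / 2` about a point of the region with aperture `t` stays in the one
  -- with aperture `2 * t + 2`.
  have h' := h (2 * t + 2) (by linarith)
  rw [Metric.tendsto_nhds] at h' ⊢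
  intro η hη
  set η' := η / (2 * (2 * t + 1))
  have hη' : 0 < η' := by positivity
  obtain ⟨r, hr, hball⟩ := Metric.mem_nhdsWithin_iff.mp (h' η' hη')
  filter_upwards [self_mem_nhdsWithin,
    (tendsto_norm_sub_stolzRegion t lam).eventually_lt_const (half_pos hr)] with z hz hzr
  have hzn : ‖z‖ < 1 := mem_ball_zero_iff.mp hz.1
  have hzt := hz.2
  have hgap : 1 - ‖z‖ ≤ ‖z - (lam : ℂ)‖ := by
    rw [norm_sub_rev]; exact one_sub_norm_le_norm_sub z lam
  set R := (1 - ‖z‖) / 2 with hR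
  have hRpos : 0 < R := by rw [hR]; linarith
  have hsub : ∀ w, dist w z ≤ R → ‖w‖ < 1 ∧ ‖w - lam‖ ≤ (2 * t + 1) * R ∧
      ‖w - lam‖ < (2 * t + 2) * (1 - ‖w‖) ∧ ‖w - lam‖ < r := fun w hw => by
    rw [dist_eq_norm] at hw
    have h1 : ‖w‖ ≤ ‖w - z‖ + ‖z‖ := by simpa using norm_add_le (w - z) z
    have h2 := norm_sub_le_norm_sub_add_norm_sub w z (lam : ℂ)
    refine ⟨by linarith, by nlinarith, by nlinarith, by linarith⟩
  -- Subtracting the expected affine part leaves derivative `g' - A` and size at most `η' * |λ -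
  -- w|`, so Cauchy's estimate gives `η' * (2 * t + 1) = η / 2`.
  let G : ℂ → F := fun w => g w - (a - ((lam : ℂ) - w) • A)
  have hdiff : ∀ w, ‖w‖ < 1 → DifferentiableAt ℂ g w := fun w hw =>
    hg.differentiableAt (Metric.isOpen_ball.mem_nhds (mem_ball_zero_iff.mpr hw))
  have hGd : DiffContOnCl ℂ G (Metric.ball z R) := by
    refine DifferentiableOn.diffContOnCl fun w hw => ?_
    rw [closure_ball z hRpos.ne'] at hw
    have := hdiff w (hsub w hw).1
    exact DifferentiableAt.differentiableWithinAt (by fun_prop)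
  have hGb : ∀ w ∈ Metric.sphere z R, ‖G w‖ ≤ η' * ((2 * t + 1) * R) := fun w hw => by
    obtain ⟨h1, h2, h3, h4⟩ := hsub w (le_of_eq hw)
    have h5 : dist (((lam : ℂ) - w)⁻¹ • (a - g w)) A < η' :=
      hball ⟨mem_ball_iff_norm.mpr h4, mem_ball_zero_iff.mpr h1, h3⟩
    have hne := circle_sub_ne_zero h1 lam
    have h6 : G w = -(((lam : ℂ) - w) • (((lam : ℂ) - w)⁻¹ • (a - g w) - A)) := by
      rw [smul_sub, smul_inv_smul₀ hne]
      simp only [G]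
      abel
    rw [dist_eq_norm] at h5
    rw [h6, norm_neg, norm_smul, norm_sub_rev, mul_comm]
    gcongr
  have hderiv : deriv G z = deriv g z - A := by
    have h1 : HasDerivAt (fun w : ℂ => a - ((lam : ℂ) - w) • A) A z := by
      have := (((hasDerivAt_id z).const_sub (lam : ℂ)).smul_const A).const_sub a
      simpa using this
    exact ((hdiff z hzn).hasDerivAt.sub h1).deriv
  have hle := Complex.norm_deriv_le_of_forall_mem_sphere_norm_le hRpos hGd hGb
  rw [dist_eq_norm, ← hderiv]
  refine hle.trans_lt ?_
  rw [← mul_assoc, mul_div_assoc, div_self hRpos.ne', mul_one]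
  have : η' * (2 * t + 1) = η / 2 := by
    simp only [η']
    field_simp
  linarith

end AngularDerivative

/-! ### Weak convergence and inversion on the range in finite dimension. -/

section FiniteDimensional

variable {V : Type*} [NormedAddCommGroup V] [InnerProductSpace ℂ V] [FiniteDimensional ℂ V]

/-- On a finite-dimensional space, weak operator convergence is norm convergence. -/
lemma tendsto_of_tendsto_inner {ι : Type*} {l : Filter ι} {T : ι → V →L[ℂ] V} {A : V →L[ℂ] V}
    (h : ∀ x y, Tendsto (fun i => inner ℂ (T i x) y) l (𝓝 (inner ℂ (A x) y))) :
    Tendsto T l (𝓝 A) := by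
  let L : (V →L[ℂ] V) →ₗ[ℂ] (V → V → ℂ) :=
    { toFun := fun T x y => inner ℂ y (T x)
      map_add' := fun S T => by
        ext x y
        simp
      map_smul' := fun c T => by
        ext x y
        simp }
  have hL : LinearMap.ker L = ⊥ := by
    refine LinearMap.ker_eq_bot.mpr fun S T hST => ?_
    ext1 x
    exact ext_inner_left ℂ fun y => congrFun (congrFun hST x) y
  have hind := (LinearMap.isClosedEmbedding_of_injective hL).isInducing
  rw [hind.tendsto_nhds_iff, tendsto_pi_nhds]
  intro x
  rw [tendsto_pi_nhds]
  intro y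
  have h1 := (Complex.continuous_conj.tendsto _).comp (h x y)
  simp only [inner_conj_symm, Function.comp_def] at h1
  exact h1

/-- A self-adjoint operator on a finite-dimensional space is invertible on its range. -/
lemma exists_inverse_on_range [CompleteSpace V] {M : V →L[ℂ] V} (hM : IsSelfAdjoint M) :
    ∃ X : V →L[ℂ] V, M * X = M.range.starProjection ∧ X * M = M.range.starProjection ∧
      M.range.starProjection * X = X ∧ X * M.range.starProjection = X := by
  set P : V →L[ℂ] V := M.range.starProjection with hP
  have hPP : P * P = P := (isStarProjection_starProjection (U := M.range)).isIdempotentElem.eq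
  have hPM : P * M = M := by
    ext1 x
    exact Submodule.starProjection_eq_self_iff.mpr ⟨x, rfl⟩
  have hPs : star P = P :=
    (isStarProjection_starProjection (U := M.range)).isSelfAdjoint.star_eq
  have hMP : M * P = M := by
    have := congrArg star hPM
    rwa [star_mul, hM.star_eq, hPs] at this
  -- Adding the identity on the orthogonal complement of the range makes `M` invertible; compressing
  -- that inverse by `P` gives `X`.
  have hinj : Function.Injective (M + (1 - P) : V →L[ℂ] V) := by
    refine (injective_iff_map_eq_zero _).mpr fun x hx => ?_
    have h1 : M x = 0 := by
      have h2 : P * (M + (1 - P)) = M := by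
        rw [mul_add, mul_sub, hPM, mul_one, hPP, sub_self, add_zero]
      rw [← h2, mul_apply_eq_comp, hx, map_zero]
    have h3 : x = P x := by
      have : M x + (x - P x) = 0 := hx
      rw [h1, zero_add, sub_eq_zero] at this
      exact this
    obtain ⟨y, hy⟩ : P x ∈ M.range := Submodule.starProjection_apply_mem _ _
    have h4 : inner ℂ x x = 0 := by
      nth_rewrite 1 [h3]
      rw [← hy]
      have := (ContinuousLinearMap.isSelfAdjoint_iff_isSymmetric.mp hM) y x
      refine this.trans ?_
      simp [h1]
    exact inner_self_eq_zero.mp h4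
  have hunit : IsUnit (M + (1 - P)) := by
    rw [ContinuousLinearMap.isUnit_iff_bijective]
    exact ⟨hinj, (LinearMap.injective_iff_surjective
      (f := ((M + (1 - P) : V →L[ℂ] V) : V →ₗ[ℂ] V))).mp hinj⟩
  obtain ⟨Z, hZ⟩ := hunit
  have hZ1 : (M + (1 - P)) * ↑Z⁻¹ = 1 := by rw [← hZ, Units.mul_inv]
  have hZ2 : ↑Z⁻¹ * (M + (1 - P)) = 1 := by rw [← hZ, Units.inv_mul]
  have h1 : M * ↑Z⁻¹ = P := by
    have h2 : P * (M + (1 - P)) = M := by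
      rw [mul_add, mul_sub, hPM, mul_one, hPP, sub_self, add_zero]
    rw [← h2, mul_assoc, hZ1, mul_one]
  have h2 : ↑Z⁻¹ * M = P := by
    have h3 : (M + (1 - P)) * P = M := by
      rw [add_mul, sub_mul, hMP, one_mul, hPP, sub_self, add_zero]
    rw [← h3, ← mul_assoc, hZ2, one_mul]
  have hcomm : P * ↑Z⁻¹ = ↑Z⁻¹ * P := by
    nth_rewrite 1 [← h2]
    rw [mul_assoc, h1]
  refine ⟨↑Z⁻¹ * P, ?_, ?_, ?_, ?_⟩
  · rw [← mul_assoc, h1, hPP]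
  · rw [mul_assoc, hPM, h2]
  · rw [← mul_assoc, hcomm, mul_assoc, hPP]
  · rw [mul_assoc, hPP]

end FiniteDimensional

/-! ### Application to the Aleksandrov–Clark measure. -/

lemma IsClarkMeasure.isHerglotzRepr {V : Type*} [NormedAddCommGroup V] [InnerProductSpace ℂ V]
    [CompleteSpace V] {b : ℂ → V →L[ℂ] V} (hb : IsSchur b) {α : unitary (V →L[ℂ] V)}
    {μ : VectorMeasure UnitCircle (V →L[ℂ] V)} (hμ : IsClarkMeasure b α μ) :
    IsHerglotzRepr (fun z => b z * star (α : V →L[ℂ] V))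
      (imaginaryPart (herglotzFun b α 0) : V →L[ℂ] V) μ where
  norm_lt_one z hz := by
    have h1 : ‖b z * star (α : V →L[ℂ] V)‖ = ‖b z‖ :=
      CStarRing.norm_mul_mem_unitary _ (Unitary.star_mem α.2)
    rw [h1]
    exact hb.norm_lt_one z (mem_ball_zero_iff.mpr hz)
  isPositive := hμ.nonneg
  isSelfAdjoint := (imaginaryPart (herglotzFun b α 0)).2
  cayley_eq z hz := hμ.herglotz z (mem_ball_zero_iff.mpr hz)

theorem theorem7p2 {n : ℕ} (b : ℂ → Op n) (hb : IsSchur b) (α : unitary (Op n))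
    (μ : VectorMeasure UnitCircle (Op n)) (hμ : IsClarkMeasure b α μ)
    (lam : UnitCircle) (hlam : μ {lam} ≠ 0)
    (E : Submodule ℂ (EuclideanSpace ℂ (Fin n))) (hE : E = (μ {lam}).range) :
    ∃ A : Op n, HasCADOn (fun z => b z * star (α : Op n)) E lam A ∧
      IsMoorePenroseInverse A ((lam : ℂ) • μ {lam}) := by
  subst hE
  have hfin := isFiniteMeasure_variation_of_isPositive hμ.nonneg
  have h := hμ.isHerglotzRepr hb
  have hsa := (hμ.nonneg _ (measurableSet_singleton lam)).isSelfAdjoint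
  obtain ⟨X, hMX, hXM, hPX, hXP⟩ := exists_inverse_on_range hsa
  set P : Op n := (μ {lam}).range.starProjection with hP
  have hPs : IsStarProjection P := isStarProjection_starProjection
  have hPP : P * P = P := hPs.isIdempotentElem.eq
  have hPadj : ∀ x y, inner ℂ (P x) y = inner ℂ x (P y) := fun x y =>
    (ContinuousLinearMap.isSelfAdjoint_iff_isSymmetric.mp hPs.isSelfAdjoint) x y
  set θ : ℂ → Op n := fun z => b z * star (α : Op n) with hθ
  have hθd : DifferentiableOn ℂ θ (Metric.ball 0 1) := hb.differentiableOn.mul_const _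
  have hll : starRingEnd ℂ (lam : ℂ) * lam = 1 := by
    rw [mul_comm, Complex.mul_conj, Complex.normSq_eq_norm_sq, UnitCircle.norm_coe]
    simp
  -- The tested limit forces `M A M = conj λ • M`, which on the range of `M` means `A = conj λ • X`.
  refine ⟨starRingEnd ℂ (lam : ℂ) • X, ⟨?_, ?_⟩, ?_⟩
  · rintro _ ⟨v, rfl⟩ t -
    exact h.tendsto_apply lam t v
  · have hquot : NontangentialTendsto (fun z => ((lam : ℂ) - z)⁻¹ • (P - P * θ z * P)) lam
        (starRingEnd ℂ (lam : ℂ) • X) := by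
      intro t _
      refine tendsto_of_tendsto_inner fun x y => ?_
      -- Since `M X = P`, testing on `X x` and `X y` yields the quotient compressed by `P` on
      -- arbitrary vectors `x`, `y`.
      have h1 := h.tendsto_inner_differenceQuotient lam t (X y) (X x)
      have hM : ∀ w, μ {lam} (X w) = P w := fun w => DFunLike.congr_fun hMX w
      have hPXw : ∀ w, P (X w) = X w := fun w => DFunLike.congr_fun hPX w
      have hPPw : ∀ w, P (P w) = P w := fun w => DFunLike.congr_fun hPP w
      rw [hM, hM, ← hPadj, hPXw] at h1
      convert h1 using 2 with z
      · rw [_root_.smul_apply, inner_smul_left, inner_smul_left, ← hPadj]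
        congr 2
        simp [hPPw]
      · rw [_root_.smul_apply, inner_smul_left, Complex.conj_conj]
    have hd := nontangentialTendsto_deriv
      ((hθd.const_mul P).mul_const P) hquot
    intro t ht
    refine (hd t ht).congr' (eventually_nhdsWithin_of_forall fun z hz => ?_)
    have hz' := hθd.differentiableAt (Metric.isOpen_ball.mem_nhds hz.1)
    exact ((hz'.hasDerivAt.const_mul P).mul_const P).deriv
  · have hAM : (starRingEnd ℂ (lam : ℂ) • X) * ((lam : ℂ) • μ {lam}) = P := by
      rw [smul_mul_smul_comm, hll, one_smul, hXM]
    have hMA : ((lam : ℂ) • μ {lam}) * (starRingEnd ℂ (lam : ℂ) • X) = P := by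
      rw [smul_mul_smul_comm, mul_comm, hll, one_smul, hMX]
    refine ⟨?_, ?_, ?_, ?_⟩
    · rw [hAM, mul_smul_comm, hPX]
    · rw [hMA, mul_smul_comm]
      congr 1
      ext1 x
      exact Submodule.starProjection_eq_self_iff.mpr ⟨x, rfl⟩
    · rw [hAM, hPs.isSelfAdjoint.star_eq]
    · rw [hMA, hPs.isSelfAdjoint.star_eq]
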